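/- Let $M$ be a smooth closed (compact, without boundary) connected $n$-manifold, $n\ge 3$, and let $g$ be a smooth Riemannian metric on $M$ with constant scalar curvature $R(g)=-1$. Let $\mathrm{Ric}(g)$ be its Ricci tensor, $\mathrm{Ric}^T(g)=\mathrm{Ric}(g)-\tfrac1n R(g)\,g$ the traceless part, $|\cdot|_g$ the pointwise $g$-norm of tensors (in local coordinates $|T|_g^2=g^{ik}g^{jl}T_{ij}T_{kl}$), and let $\Delta_g=-\operatorname{tr}_g\mathrm{Hess}_g$ be the Laplacian, with the sign for which it is a positive operator. Let $p\in C^\infty(M,\mathbb R)$ be a solution of $$(n-1)\Delta_g p+p=2\,|\mathrm{Ric}^T(g)|_g^2 .$$ Then $p\ge 0$ on $M$. More precisely, either (a) $p\equiv 0$ and $\mathrm{Ric}(g)=-\tfrac1n g$, or (b) $p>0$ everywhere on $M$ and $\mathrm{Ric}(g)\neq-\tfrac1n g$; moreover, in this case $g$ is not an Einstein metric, i.e. there is no constant $c$ with $\mathrm{Ric}(g)=c\,g$. -/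

import Mathlib

open scoped Manifold ContDiff

namespace ConformalPressure

/-- Smooth Riemannian metrics on an `n`-dimensional manifold `M`. -/
abbrev Metric (n : ℕ) (M : Type*) [TopologicalSpace M] [ChartedSpace (EuclideanSpace ℝ (Fin n)) M]
    [IsManifold (𝓡 n) ∞ M] :=
  Bundle.ContMDiffRiemannianMetric (𝓡 n) ∞ (EuclideanSpace ℝ (Fin n))
    (TangentSpace (𝓡 n) : M → Type _)

/-- The partial derivative `∂ᵢ f` of a function of `n` real variables. -/
noncomputable def pd {n : ℕ} (i : Fin n) (f : EuclideanSpace ℝ (Fin n) → ℝ)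
    (u : EuclideanSpace ℝ (Fin n)) : ℝ :=
  fderiv ℝ f u (EuclideanSpace.single i 1)

section Coordinates

variable {n : ℕ} {M : Type*} [TopologicalSpace M] [ChartedSpace (EuclideanSpace ℝ (Fin n)) M]

/-- The coordinate vector field `∂ᵢ` of the preferred chart `φ` at `x₀`, at the point with
coordinates `u`, i.e. at `φ⁻¹ u`. -/
noncomputable def coordVec (x₀ : M) (i : Fin n) (u : EuclideanSpace ℝ (Fin n)) :
    TangentSpace (𝓡 n) ((extChartAt (𝓡 n) x₀).symm u) :=
  mfderiv (𝓡 n) (𝓡 n) (extChartAt (𝓡 n) x₀).symm u (EuclideanSpace.single i (1 : ℝ))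

/-- The basis `(∂ᵢ)` of the tangent space at `x` given by the preferred chart at `x`. (A tangent
vector at `x` is by definition represented by its coordinate vector in that chart.) -/
noncomputable def coordBasis (x : M) : Module.Basis (Fin n) ℝ (TangentSpace (𝓡 n) x) :=
  (EuclideanSpace.basisFun (Fin n) ℝ).toBasis

variable [IsManifold (𝓡 n) ∞ M] (g : Metric n M)

/-- The matrix `(gᵢⱼ)` of the metric in the preferred chart at `x₀`, as a function of the
coordinates `u`. -/
noncomputable def gMat (x₀ : M) (u : EuclideanSpace ℝ (Fin n)) : Matrix (Fin n) (Fin n) ℝ :=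
  Matrix.of fun i j =>
    g.inner ((extChartAt (𝓡 n) x₀).symm u) (coordVec x₀ i u) (coordVec x₀ j u)

/-- The inverse matrix `(gⁱʲ)`. -/
noncomputable def gInv (x₀ : M) (u : EuclideanSpace ℝ (Fin n)) : Matrix (Fin n) (Fin n) ℝ :=
  (gMat g x₀ u)⁻¹

/-- The Christoffel symbols
`Γᵏᵢⱼ = ½ ∑ₗ gᵏˡ (∂ᵢ gⱼₗ + ∂ⱼ gᵢₗ - ∂ₗ gᵢⱼ)` of the Levi-Civita connection. -/
noncomputable def christoffel (x₀ : M) (k i j : Fin n) (u : EuclideanSpace ℝ (Fin n)) : ℝ :=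
  (1 / 2 : ℝ) * ∑ l, gInv g x₀ u k l *
    (pd i (fun w => gMat g x₀ w j l) u + pd j (fun w => gMat g x₀ w i l) u
      - pd l (fun w => gMat g x₀ w i j) u)

/-- The components `Rᵃ_{bcd} = dxᵃ(∇_c ∇_d ∂_b - ∇_d ∇_c ∂_b)` of the Riemann curvature tensor. -/
noncomputable def riemCoord (x₀ : M) (a b c d : Fin n) (u : EuclideanSpace ℝ (Fin n)) : ℝ :=
  pd c (christoffel g x₀ a d b) u - pd d (christoffel g x₀ a c b) u
    + ∑ m, (christoffel g x₀ a c m u * christoffel g x₀ m d b u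
      - christoffel g x₀ a d m u * christoffel g x₀ m c b u)

/-- The components `Rᵢⱼ = ∑ₐ Rᵃ_{iaj}` of the Ricci tensor. -/
noncomputable def ricCoord (x₀ : M) (i j : Fin n) (u : EuclideanSpace ℝ (Fin n)) : ℝ :=
  ∑ a, riemCoord g x₀ a i a j u

/-- The components `f_{|i|j} = ∂ᵢ ∂ⱼ f - ∑ₖ Γᵏᵢⱼ ∂ₖ f` of the Hessian of a function `f` of the
coordinates of the preferred chart at `x₀`. -/
noncomputable def hessCoord (x₀ : M) (f : EuclideanSpace ℝ (Fin n) → ℝ) (i j : Fin n)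
    (u : EuclideanSpace ℝ (Fin n)) : ℝ :=
  pd i (pd j f) u - ∑ k, christoffel g x₀ k i j u * pd k f u

end Coordinates

section Tensors

variable {n : ℕ} {M : Type*} [TopologicalSpace M] [ChartedSpace (EuclideanSpace ℝ (Fin n)) M]
  [IsManifold (𝓡 n) ∞ M] (g : Metric n M)

/-- The metric at `x` as a bilinear form on the tangent space. -/
noncomputable def metricForm (x : M) : LinearMap.BilinForm ℝ (TangentSpace (𝓡 n) x) :=
  LinearMap.mk₂ ℝ (fun v w => g.inner x v w) (by simp) (by simp) (by simp) (by simp)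

/-- At the point `x`, the coordinate matrix `(gᵢⱼ)` is the Gram matrix of the basis `(∂ᵢ)`. -/
theorem gMat_self (x : M) (i j : Fin n) :
    gMat g x (extChartAt (𝓡 n) x x) i j = metricForm g x (coordBasis x i) (coordBasis x j) := by
  have h1 : IsManifold (𝓡 n) 1 M := IsManifold.of_le (n := ∞) (by simp)
  have key : ∀ y (hy : y = x) , ∀ v w : EuclideanSpace ℝ (Fin n), g.inner y v w = g.inner x v w := by
    rintro y rfl v w
    rfl
  have hc : ∀ i, (coordVec x i (extChartAt (𝓡 n) x x) : EuclideanSpace ℝ (Fin n)) = EuclideanSpace.single i 1 := by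
    intro i
    have h2 := mfderivWithin_extChartAt_symm_comp_mfderiv_extChartAt' (I := 𝓡 n) (x := x) (y := x) (mem_extChartAt_source x)
    have h3 : mfderiv (𝓡 n) (𝓡 n) (extChartAt (𝓡 n) x) x = ContinuousLinearMap.id ℝ (EuclideanSpace ℝ (Fin n)) := by
      rw [← TangentBundle.continuousLinearMapAt_trivializationAt (mem_chart_source _ x),
        TangentBundle.continuousLinearMapAt_trivializationAt_eq_core (mem_chart_source _ x)]
      ext1 v
      exact tangentCoordChange_self (I := 𝓡 n) (mem_extChartAt_source x)
    have h4 := congrArg (fun L => L (EuclideanSpace.single i (1:ℝ) : EuclideanSpace ℝ (Fin n))) h2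
    rw [h3] at h4
    simp only [ModelWithCorners.range_eq_univ, mfderivWithin_univ] at h4
    exact h4
  unfold gMat
  simp only [Matrix.of_apply, metricForm, LinearMap.mk₂_apply]
  refine (key _ (extChartAt_to_inv x) _ _).trans ?_
  have hb : ∀ i, coordBasis x i = (EuclideanSpace.single i (1:ℝ) : EuclideanSpace ℝ (Fin n)) := by
    intro i
    change (EuclideanSpace.basisFun (Fin n) ℝ).toBasis i = _
    simp
  rw [hb, hb]
  exact congrArg₂ (fun v w : EuclideanSpace ℝ (Fin n) => g.inner x v w) (hc i) (hc j)

/-- The inverse `(gⁱʲ)` of the Gram matrix of the metric in the basis `(∂ᵢ)` at `x`. -/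
noncomputable def invGram (x : M) : Matrix (Fin n) (Fin n) ℝ :=
  (Matrix.of fun i j => metricForm g x (coordBasis x i) (coordBasis x j))⁻¹

/-- The metric trace `tr_g T = gⁱʲ Tᵢⱼ` of a bilinear form `T` on the tangent space at `x`. -/
noncomputable def metricTrace {x : M} (T : LinearMap.BilinForm ℝ (TangentSpace (𝓡 n) x)) : ℝ :=
  ∑ i, ∑ j, invGram g x i j * T (coordBasis x i) (coordBasis x j)

/-- The squared norm `|T|²_g = gⁱᵏ gʲˡ Tᵢⱼ Tₖₗ` of a bilinear form `T` on the tangent space at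
`x`. -/
noncomputable def normSq {x : M} (T : LinearMap.BilinForm ℝ (TangentSpace (𝓡 n) x)) : ℝ :=
  ∑ i, ∑ j, ∑ k, ∑ l, invGram g x i k * invGram g x j l *
    T (coordBasis x i) (coordBasis x j) * T (coordBasis x k) (coordBasis x l)

/-- The Ricci tensor `Ric(g) = ∑ᵢⱼ Rᵢⱼ dxⁱ ⊗ dxʲ` at `x`. -/
noncomputable def ricci (x : M) : LinearMap.BilinForm ℝ (TangentSpace (𝓡 n) x) :=
  ∑ i, ∑ j, ricCoord g x i j (extChartAt (𝓡 n) x x) •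
    LinearMap.BilinForm.linMulLin ((coordBasis x).coord i) ((coordBasis x).coord j)

/-- The Hessian `Hess_g f = ∑ᵢⱼ f_{|i|j} dxⁱ ⊗ dxʲ` at `x` of a function `f` on `M`. -/
noncomputable def hessian (f : M → ℝ) (x : M) : LinearMap.BilinForm ℝ (TangentSpace (𝓡 n) x) :=
  ∑ i, ∑ j, hessCoord g x (f ∘ (extChartAt (𝓡 n) x).symm) i j (extChartAt (𝓡 n) x x) •
    LinearMap.BilinForm.linMulLin ((coordBasis x).coord i) ((coordBasis x).coord j)

/-- The scalar curvature `R(g) = tr_g Ric(g)`. -/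
noncomputable def scalarCurvature (x : M) : ℝ :=
  metricTrace g (ricci g x)

/-- The traceless part `Ricᵀ(g) = Ric(g) - (1/n) R(g) g` of the Ricci tensor. -/
noncomputable def tracelessRicci (x : M) : LinearMap.BilinForm ℝ (TangentSpace (𝓡 n) x) :=
  ricci g x - (1 / (n : ℝ) * scalarCurvature g x) • metricForm g x

/-- The Laplace operator with the sign for which it is a positive operator,
`Δ_g f = - tr_g (Hess_g f) = - gⁱʲ f_{|i|j}`. -/
noncomputable def laplacian (f : M → ℝ) (x : M) : ℝ :=
  -metricTrace g (hessian g f x)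

/-- `Ric(g) = c g` for the constant `c`. -/
def RicciEqConstMul (c : ℝ) : Prop :=
  ∀ x, ricci g x = c • metricForm g x

/-- `g` is an Einstein metric. -/
def IsEinstein : Prop :=
  ∃ c : ℝ, RicciEqConstMul g c

/-- `g ∈ 𝓜₋₁`: the scalar curvature of `g` is constant, equal to `-1`. -/
def HasScalarCurvatureNegOne : Prop :=
  ∀ x, scalarCurvature g x = -1

end Tensors

end ConformalPressure

/-!
The right-hand side of the equation is nonnegative, so `p` satisfies `-Δ p ≤ p / (n - 1)`. At a
minimum of `p` the Laplacian is nonpositive (`laplacian_nonpos_of_isLocalMin`), whence `p ≥ 0`.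

A nonnegative function with this property obeys the strong minimum principle: its zeros form an open
set (`isOpen_zeros_of_laplacian_le`). As `M` is connected, `p` vanishes identically or nowhere. If
`p = 0`, the equation gives `|Ricᵀ|² = 0`, and since the norm is definite
(`eq_zero_of_normSq_eq_zero`), `Ric = -g / n`. If `p > 0` and `Ric = c g`, then `Ricᵀ = 0`
(`tracelessRicci_eq_zero_of_ricci_eq`), and the equation at a maximum of `p`, where `Δ p ≥ 0`,
forces `p ≤ 0` there, a contradiction.

The strong minimum principle is proved in a chart (`eventually_eq_zero_of_supersolution`) by Hopf's
argument: a zero on the boundary of a ball without other zeros is excluded by a barrier touching the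
function from below (`false_of_supersolution_touching`). No boundary derivative is needed, because
the comparison takes place in a full small ball about that zero.

The Laplacian is defined at each point through the preferred chart at that point, whereas the
minimum principle needs one differential operator with continuous coefficients near a given point.
The two are reconciled by the tensoriality of the Hessian (`hessForm_pullback`) and the invariance
of the metric trace (`sum_inv_mul_congr_transpose_mul_mul`), which give
`laplacian_eq_sum_of_mem_source`.
-/

namespace ConformalPressure

open Filter Topology

/-! ### Second derivatives in coordinates and at a local minimum -/

theorem pd_pd_eq {n : ℕ} {f : EuclideanSpace ℝ (Fin n) → ℝ} {u : EuclideanSpace ℝ (Fin n)}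
    (hf : ContDiffAt ℝ 2 f u) (i j : Fin n) :
    pd i (pd j f) u =
      fderiv ℝ (fderiv ℝ f) u (EuclideanSpace.single i 1) (EuclideanSpace.single j 1) := by
  have h : DifferentiableAt ℝ (fderiv ℝ f) u :=
    (hf.fderiv_right (m := 1) (by norm_num)).differentiableAt (by norm_num)
  unfold pd
  rw [fderiv_clm_apply h (differentiableAt_const _)]
  simp

/-- The second derivative at a local minimum is nonnegative in every direction: a negative one would
make the minimum also a local maximum along a line, so that the function is constant there. -/
theorem fderiv_fderiv_nonneg_of_isLocalMin {E : Type*} [NormedAddCommGroup E] [NormedSpace ℝ E]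
    {f : E → ℝ} {u : E} (hf : ContDiffAt ℝ 2 f u) (hmin : IsLocalMin f u) (v : E) :
    0 ≤ fderiv ℝ (fderiv ℝ f) u v v := by
  by_contra! hneg
  set φ : ℝ → ℝ := fun t => f (u + t • v)
  have hl : ∀ t : ℝ, HasDerivAt (fun t : ℝ => u + t • v) v t := fun t => by
    simpa using ((hasDerivAt_id t).smul_const v).const_add u
  have hl0 : Tendsto (fun t : ℝ => u + t • v) (𝓝 0) (𝓝 u) := by
    simpa using (hl 0).continuousAt.tendsto
  have hev : deriv φ =ᶠ[𝓝 0] fun t => fderiv ℝ f (u + t • v) v := by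
    filter_upwards [hl0.eventually (hf.eventually (by simp))] with t ht
    exact ((ht.differentiableAt (by norm_num)).hasFDerivAt.comp_hasDerivAt t (hl t)).deriv
  have hd : DifferentiableAt ℝ (fderiv ℝ f) u :=
    (hf.fderiv_right (m := 1) (by norm_num)).differentiableAt (by norm_num)
  have hdd : deriv (deriv φ) 0 = fderiv ℝ (fderiv ℝ f) u v v := by
    rw [hev.deriv_eq]
    have h1 : HasDerivAt (fun t : ℝ => fderiv ℝ f (u + t • v)) (fderiv ℝ (fderiv ℝ f) u v) 0 :=
      hd.hasFDerivAt.comp_hasDerivAt_of_eq (0 : ℝ) (hl 0) (by simp)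
    have h2 := h1.clm_apply (hasDerivAt_const (0 : ℝ) v)
    rw [h2.deriv, map_zero, add_zero]
  have hφmin : IsLocalMin φ 0 := by
    have := hl0.eventually hmin
    filter_upwards [this] with t ht
    simpa [φ] using ht
  have hφmax : IsLocalMax φ 0 := by
    refine isLocalMax_of_deriv_deriv_neg (by rw [hdd]; exact hneg) hφmin.deriv_eq_zero ?_
    have hf0 : ContinuousAt f (u + (0 : ℝ) • v) := by simpa using hf.continuousAt
    exact ContinuousAt.comp (g := f) (f := fun t : ℝ => u + t • v) hf0 (hl 0).continuousAt
  have hconst : φ =ᶠ[𝓝 0] fun _ => φ 0 := by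
    filter_upwards [hφmin, hφmax] with t h1 h2 using le_antisymm h2 h1
  have h2 : deriv φ =ᶠ[𝓝 0] fun _ => 0 := by
    simpa using hconst.deriv
  rw [← hdd, h2.deriv_eq] at hneg
  simp at hneg

/-- A positive semidefinite matrix pairs nonnegatively with a nonnegative quadratic form: factor
the matrix as `Bᵀ B`, so that the pairing is a sum of values of the form. -/
theorem sum_posSemidef_mul_bilin_nonneg {n : ℕ} {E : Type*} [NormedAddCommGroup E]
    [NormedSpace ℝ E] {a : Matrix (Fin n) (Fin n) ℝ} (ha : a.PosSemidef) (e : Fin n → E)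
    (S : E →L[ℝ] E →L[ℝ] ℝ) (hS : ∀ v, 0 ≤ S v v) :
    0 ≤ ∑ i, ∑ j, a i j * S (e i) (e j) := by
  open scoped MatrixOrder in
  obtain ⟨B, rfl⟩ := CStarAlgebra.nonneg_iff_eq_star_mul_self.mp ha.nonneg
  have : ∑ i, ∑ j, (star B * B) i j * S (e i) (e j) =
      ∑ k, S (∑ i, B k i • e i) (∑ j, B k j • e j) := by
    simp only [Matrix.mul_apply, Matrix.star_apply, star_trivial, Finset.sum_mul, map_sum, map_smul,
      sum_apply, smul_apply, smul_eq_mul, Finset.mul_sum]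
    rw [Finset.sum_comm]
    conv_lhs => enter [2, j]; rw [Finset.sum_comm]
    rw [Finset.sum_comm]
    refine Finset.sum_congr rfl fun k _ => Finset.sum_congr rfl fun i _ =>
      Finset.sum_congr rfl fun j _ => ?_
    ring
  rw [this]
  exact Finset.sum_nonneg fun k _ => hS _

theorem sum_mul_pd_pd_nonneg_of_isLocalMin {n : ℕ} {a : Matrix (Fin n) (Fin n) ℝ}
    (ha : a.PosSemidef) {f : EuclideanSpace ℝ (Fin n) → ℝ} {u : EuclideanSpace ℝ (Fin n)}
    (hf : ContDiffAt ℝ 2 f u) (hmin : IsLocalMin f u) :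
    0 ≤ ∑ i, ∑ j, a i j * pd i (pd j f) u := by
  simp only [pd_pd_eq hf]
  exact sum_posSemidef_mul_bilin_nonneg ha _ _ (fderiv_fderiv_nonneg_of_isLocalMin hf hmin)

theorem pd_eq_zero_of_isLocalMin {n : ℕ} {f : EuclideanSpace ℝ (Fin n) → ℝ}
    {u : EuclideanSpace ℝ (Fin n)} (hmin : IsLocalMin f u) (k : Fin n) : pd k f u = 0 := by
  simp [pd, hmin.fderiv_eq_zero]

theorem pd_sub_const_mul {n : ℕ} {f h : EuclideanSpace ℝ (Fin n) → ℝ}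
    {u : EuclideanSpace ℝ (Fin n)} (hf : DifferentiableAt ℝ f u) (hh : DifferentiableAt ℝ h u)
    (ε : ℝ) (k : Fin n) : pd k (fun w => f w - ε * h w) u = pd k f u - ε * pd k h u := by
  unfold pd
  rw [fderiv_fun_sub hf (hh.const_mul ε), fderiv_const_mul hh]
  simp

theorem contDiffAt_pd {n : ℕ} {f : EuclideanSpace ℝ (Fin n) → ℝ} {u : EuclideanSpace ℝ (Fin n)}
    {m k : WithTop ℕ∞} (hf : ContDiffAt ℝ m f u) (hk : k + 1 ≤ m) (i : Fin n) :
    ContDiffAt ℝ k (pd i f) u :=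
  (hf.fderiv_right hk).clm_apply contDiffAt_const

theorem pd_pd_sub_const_mul {n : ℕ} {f h : EuclideanSpace ℝ (Fin n) → ℝ}
    {u : EuclideanSpace ℝ (Fin n)} (hf : ContDiffAt ℝ 2 f u) (hh : ContDiffAt ℝ 2 h u)
    (ε : ℝ) (i j : Fin n) :
    pd i (pd j (fun w => f w - ε * h w)) u = pd i (pd j f) u - ε * pd i (pd j h) u := by
  have : pd j (fun w => f w - ε * h w) =ᶠ[𝓝 u] fun w => pd j f w - ε * pd j h w := by
    filter_upwards [hf.eventually (by simp), hh.eventually (by simp)] with w h1 h2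
    exact pd_sub_const_mul (h1.differentiableAt (by norm_num)) (h2.differentiableAt (by norm_num))
      ε j
  rw [show pd i (pd j (fun w => f w - ε * h w)) u =
    pd i (fun w => pd j f w - ε * pd j h w) u by unfold pd at this ⊢; rw [this.fderiv_eq]]
  exact pd_sub_const_mul ((contDiffAt_pd hf (k := 1) (by norm_num) j).differentiableAt
      (by norm_num))
    ((contDiffAt_pd hh (k := 1) (by norm_num) j).differentiableAt (by norm_num)) ε i

theorem pd_add_const_mul_sq {n : ℕ} {s : EuclideanSpace ℝ (Fin n) → ℝ}
    {u : EuclideanSpace ℝ (Fin n)} (hs : DifferentiableAt ℝ s u) (β : ℝ) (k : Fin n) :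
    pd k (fun w => s w + β * s w ^ 2) u = (1 + 2 * β * s u) * pd k s u := by
  have := (hs.hasFDerivAt.add ((hs.hasFDerivAt.pow 2).const_mul β)).fderiv
  unfold pd
  erw [this]
  simp
  ring

theorem pd_pd_add_const_mul_sq {n : ℕ} {s : EuclideanSpace ℝ (Fin n) → ℝ}
    {u : EuclideanSpace ℝ (Fin n)} (hs : ContDiff ℝ 2 s) (β : ℝ) (i j : Fin n) :
    pd i (pd j (fun w => s w + β * s w ^ 2)) u =
      2 * β * pd i s u * pd j s u + (1 + 2 * β * s u) * pd i (pd j s) u := by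
  have hsd : Differentiable ℝ s := hs.differentiable (by norm_num)
  have : pd j (fun w => s w + β * s w ^ 2) = fun w => (1 + 2 * β * s w) * pd j s w := by
    funext w
    exact pd_add_const_mul_sq hsd.differentiableAt β j
  rw [this]
  have h1 := (((hsd u).hasFDerivAt.const_mul (2 * β)).const_add 1).mul
    ((contDiffAt_pd (hs.contDiffAt (x := u)) (k := 1) (by norm_num) j).differentiableAt
      (by norm_num)).hasFDerivAt
  have h2 := h1.fderiv
  unfold pd at h2 ⊢
  erw [h2]
  simp
  ring

/-! ### The strong minimum principle in a Euclidean domain -/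

theorem continuousAt_sum_mul_pd {n : ℕ}
    {a : EuclideanSpace ℝ (Fin n) → Matrix (Fin n) (Fin n) ℝ}
    {b : EuclideanSpace ℝ (Fin n) → Fin n → ℝ} {h : EuclideanSpace ℝ (Fin n) → ℝ}
    {z : EuclideanSpace ℝ (Fin n)} (ha : ContinuousAt a z) (hb : ContinuousAt b z)
    (hh : ContDiffAt ℝ 2 h z) :
    ContinuousAt (fun u => (∑ i, ∑ j, a u i j * pd i (pd j h) u) + ∑ k, b u k * pd k h u) z := by
  have h1 : ∀ j, ContDiffAt ℝ 1 (pd j h) z := contDiffAt_pd hh (by norm_num)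
  have h2 : ∀ i j, ContinuousAt (pd i (pd j h)) z := fun i j =>
    (contDiffAt_pd (h1 j) (k := 0) (by norm_num) i).continuousAt
  have ha' : ∀ i j, ContinuousAt (fun u => a u i j) z := fun i j =>
    (continuous_apply_apply i j).continuousAt.comp ha
  have hb' : ∀ k, ContinuousAt (fun u => b u k) z := fun k =>
    (continuous_apply k).continuousAt.comp hb
  refine ContinuousAt.add ?_ ?_
  · exact tendsto_finsetSum _ fun i _ => tendsto_finsetSum _ fun j _ => (ha' i j).mul (h2 i j)
  · exact tendsto_finsetSum _ fun k _ => (hb' k).mul (h1 k).continuousAt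

/-- Near a point `z` where a defining function `s` vanishes with nonzero differential there is a
function `h` of class `C²` with the same sign as `s` on `{s < 0}`, with `h z = 0`, and with
`∑ aᵢⱼ ∂ᵢ∂ⱼ h + ∑ bₖ ∂ₖ h - c h > 0` near `z`. It is `h = s + β s²` with `β` large: the
second-order term contributes `2 β ∑ aᵢⱼ ∂ᵢs ∂ⱼs > 0` at `z`. -/
theorem exists_barrier {n : ℕ} {a : EuclideanSpace ℝ (Fin n) → Matrix (Fin n) (Fin n) ℝ}
    {b : EuclideanSpace ℝ (Fin n) → Fin n → ℝ} (c : ℝ) {s : EuclideanSpace ℝ (Fin n) → ℝ}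
    {z : EuclideanSpace ℝ (Fin n)} (ha : ContinuousAt a z) (hb : ContinuousAt b z)
    (hapos : (a z).PosDef) (hs : ContDiff ℝ 2 s) (hs0 : s z = 0) (hds : ∃ k, pd k s z ≠ 0) :
    ∃ h : EuclideanSpace ℝ (Fin n) → ℝ, ContDiff ℝ 2 h ∧ h z = 0 ∧
      (∀ᶠ u in 𝓝 z, s u < 0 → h u < 0) ∧
      ∀ᶠ u in 𝓝 z, c * h u <
        (∑ i, ∑ j, a u i j * pd i (pd j h) u) + ∑ k, b u k * pd k h u := by
  set Q : ℝ := ∑ i, ∑ j, a z i j * (pd i s z * pd j s z)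
  have hQ : 0 < Q := by
    obtain ⟨k, hk⟩ := hds
    have := hapos.dotProduct_mulVec_pos (x := fun i => pd i s z) (fun h0 => hk (congrFun h0 k))
    refine this.trans_eq ?_
    simp only [Q, dotProduct, Matrix.mulVec, Finset.mul_sum, Pi.star_apply, star_trivial]
    refine Finset.sum_congr rfl fun i _ => Finset.sum_congr rfl fun j _ => ?_
    ring
  set D : ℝ := (∑ i, ∑ j, a z i j * pd i (pd j s) z) + ∑ k, b z k * pd k s z
  obtain ⟨β, hβ⟩ : ∃ β : ℝ, 0 < 2 * β * Q + D := by
    refine ⟨(1 - D) / (2 * Q), ?_⟩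
    field_simp
    linarith
  have hh : ContDiff ℝ 2 (fun w => s w + β * s w ^ 2) :=
    hs.add (contDiff_const.mul (hs.pow 2))
  refine ⟨fun w => s w + β * s w ^ 2, hh, by simp [hs0], ?_, ?_⟩
  · have hc : ContinuousAt (fun w => 1 + β * s w) z := by
      have := hs.continuous
      fun_prop
    filter_upwards [hc.eventually_const_lt (u := 0) (by simp [hs0])] with u hu hsu
    nlinarith
  · refine ContinuousAt.eventually_lt (continuousAt_const.mul hh.continuous.continuousAt)
      (continuousAt_sum_mul_pd ha hb hh.contDiffAt) ?_
    have h1 : ∀ k, pd k (fun w => s w + β * s w ^ 2) z = pd k s z := fun k => by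
      rw [pd_add_const_mul_sq (hs.differentiable (by norm_num)).differentiableAt]
      simp [hs0]
    have h2 : ∀ i j, pd i (pd j (fun w => s w + β * s w ^ 2)) z =
        2 * β * (pd i s z * pd j s z) + pd i (pd j s) z := fun i j => by
      rw [pd_pd_add_const_mul_sq hs]
      simp [hs0]
      ring
    simp only [h1, h2, hs0]
    have : (∑ i, ∑ j, a z i j * (2 * β * (pd i s z * pd j s z) + pd i (pd j s) z)) =
        2 * β * Q + ∑ i, ∑ j, a z i j * pd i (pd j s) z := by
      simp only [Q, Finset.mul_sum, ← Finset.sum_add_distrib]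
      refine Finset.sum_congr rfl fun i _ => Finset.sum_congr rfl fun j _ => ?_
      ring
    rw [this]
    simp only [D] at hβ
    linarith

/-- Hopf's touching argument: a nonnegative supersolution vanishing at `z` cannot be positive on
`{s ≥ 0} \ {z}` near `z` when `s` vanishes at `z` with nonzero differential. Otherwise a small
multiple `ε h` of a barrier would touch it from below, at an interior point of a small ball, where
the differential inequalities for `f` and `h` are incompatible. -/
theorem false_of_supersolution_touching {n : ℕ}
    {a : EuclideanSpace ℝ (Fin n) → Matrix (Fin n) (Fin n) ℝ}
    {b : EuclideanSpace ℝ (Fin n) → Fin n → ℝ} {c : ℝ} (hc : 0 ≤ c)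
    {f s : EuclideanSpace ℝ (Fin n) → ℝ} {z : EuclideanSpace ℝ (Fin n)}
    (ha : ContinuousAt a z) (hb : ContinuousAt b z) (hapos : ∀ᶠ u in 𝓝 z, (a u).PosDef)
    (hf : ∀ᶠ u in 𝓝 z, ContDiffAt ℝ 2 f u) (hs : ContDiff ℝ 2 s) (hs0 : s z = 0)
    (hds : ∃ k, pd k s z ≠ 0)
    (hineq : ∀ᶠ u in 𝓝 z,
      (∑ i, ∑ j, a u i j * pd i (pd j f) u) + ∑ k, b u k * pd k f u ≤ c * f u)
    (hfnn : ∀ᶠ u in 𝓝 z, 0 ≤ f u) (hpos : ∀ᶠ u in 𝓝 z, u ≠ z → 0 ≤ s u → 0 < f u)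
    (hfz : f z = 0) : False := by
  obtain ⟨h, hh, hhz, hneg, hbar⟩ := exists_barrier c ha hb hapos.self_of_nhds hs hs0 hds
  obtain ⟨δ, hδ, hball⟩ := Metric.nhds_basis_closedBall.eventually_iff.mp
    (hapos.and (hf.and (hineq.and (hfnn.and (hpos.and (hneg.and hbar))))))
  have hfc : ContinuousOn f (Metric.closedBall z δ) := fun u hu =>
    (hball hu).2.1.continuousAt.continuousWithinAt
  have hTsub : Metric.sphere z δ ∩ {u | 0 ≤ s u} ⊆ Metric.closedBall z δ := fun u hu =>
    Metric.sphere_subset_closedBall hu.1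
  have hT : IsCompact (Metric.sphere z δ ∩ {u | 0 ≤ s u}) :=
    (isCompact_sphere z δ).inter_right (isClosed_le continuous_const hs.continuous)
  have hne : ∀ u ∈ Metric.sphere z δ, u ≠ z := fun u hu => Metric.ne_of_mem_sphere hu hδ.ne'
  obtain ⟨m, hm, hmT⟩ := hT.exists_forall_le' (hfc.mono hTsub) (a := 0) fun u hu =>
    (hball (hTsub hu)).2.2.2.2.1 (hne u hu.1) hu.2
  obtain ⟨C, hC⟩ := hT.exists_bound_of_continuousOn hh.continuous.continuousOn
  -- On the part of the sphere where `0 ≤ s`, `m ≤ f` and `h ≤ |C|`; hence `ε h < f` there.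
  set ε : ℝ := m / (|C| + 1)
  have hε : 0 < ε := by positivity
  have hεC : ε * |C| < m := by
    rw [div_mul_eq_mul_div, div_lt_iff₀ (by positivity)]
    nlinarith
  have hsph : ∀ u ∈ Metric.sphere z δ, 0 < f u - ε * h u := by
    intro u hu
    have hu' := hball (Metric.sphere_subset_closedBall hu)
    rcases le_or_gt 0 (s u) with hsu | hsu
    · have h1 := hmT u ⟨hu, hsu⟩
      have h2 : h u ≤ |C| := (le_abs_self _).trans ((hC u ⟨hu, hsu⟩).trans (le_abs_self C))
      nlinarith
    · nlinarith [hu'.2.2.2.1, hu'.2.2.2.2.2.1 hsu]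
  have hzmem : z ∈ Metric.closedBall z δ := Metric.mem_closedBall_self hδ.le
  obtain ⟨v, hv, hvmin⟩ := (isCompact_closedBall z δ).exists_isMinOn ⟨z, hzmem⟩
    (hfc.sub (continuousOn_const.mul hh.continuous.continuousOn) :
      ContinuousOn (fun u => f u - ε * h u) _)
  -- The minimum is nonpositive, because `f - ε h` vanishes at `z`, so it is not on the sphere.
  have hv0 : f v - ε * h v ≤ 0 := by
    simpa [hfz, hhz] using hvmin hzmem
  have hvball : v ∈ Metric.ball z δ := by
    rcases (Metric.mem_closedBall.mp hv).lt_or_eq with h1 | h1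
    · exact h1
    · exact absurd (hsph v h1) (not_lt.mpr hv0)
  have hloc : IsLocalMin (fun u => f u - ε * h u) v :=
    hvmin.isLocalMin (Filter.mem_of_superset (Metric.isOpen_ball.mem_nhds hvball)
      Metric.ball_subset_closedBall)
  obtain ⟨hav, hfv, hiv, -, -, -, hbv⟩ := hball hv
  have hC2 : ContDiffAt ℝ 2 (fun u => f u - ε * h u) v :=
    hfv.sub (contDiffAt_const.mul hh.contDiffAt)
  have h1 := sum_mul_pd_pd_nonneg_of_isLocalMin hav.posSemidef hC2 hloc
  simp only [pd_pd_sub_const_mul hfv hh.contDiffAt, mul_sub, Finset.sum_sub_distrib] at h1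
  have h2 : ∀ k, pd k f v = ε * pd k h v := fun k => by
    have := pd_eq_zero_of_isLocalMin hloc k
    rw [pd_sub_const_mul (hfv.differentiableAt (by norm_num))
      (hh.differentiable (by norm_num)).differentiableAt] at this
    linarith
  have h3 : ∑ k, b v k * pd k f v = ε * ∑ k, b v k * pd k h v := by
    rw [Finset.mul_sum]
    exact Finset.sum_congr rfl fun k _ => by rw [h2 k]; ring
  have h4 : ∑ i, ∑ j, a v i j * (ε * pd i (pd j h) v) =
      ε * ∑ i, ∑ j, a v i j * pd i (pd j h) v := by
    simp only [Finset.mul_sum]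
    exact Finset.sum_congr rfl fun i _ => Finset.sum_congr rfl fun j _ => by ring
  rw [h4] at h1
  rw [h3] at hiv
  have h5 := mul_lt_mul_of_pos_left hbv hε
  have h6 := mul_le_mul_of_nonneg_left hv0 hc
  linarith

/-- The strong minimum principle, local form: the zeros of a nonnegative supersolution of a
second-order elliptic equation in an open set form an open set. A zero `z` nearest to a point `u₁`
with `f u₁ > 0` lies on the boundary of a ball, the one with diameter `[u₁, z]`, that contains no
other zero; this contradicts `false_of_supersolution_touching`. -/
theorem eventually_eq_zero_of_supersolution {n : ℕ}
    {a : EuclideanSpace ℝ (Fin n) → Matrix (Fin n) (Fin n) ℝ}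
    {b : EuclideanSpace ℝ (Fin n) → Fin n → ℝ} {c : ℝ} (hc : 0 ≤ c)
    {f : EuclideanSpace ℝ (Fin n) → ℝ} {U : Set (EuclideanSpace ℝ (Fin n))} (hU : IsOpen U)
    (ha : ContinuousOn a U) (hb : ContinuousOn b U) (hapos : ∀ u ∈ U, (a u).PosDef)
    (hf : ContDiffOn ℝ 2 f U)
    (hineq : ∀ u ∈ U,
      (∑ i, ∑ j, a u i j * pd i (pd j f) u) + ∑ k, b u k * pd k f u ≤ c * f u)
    (hfnn : ∀ u ∈ U, 0 ≤ f u) {u₀ : EuclideanSpace ℝ (Fin n)} (hu₀ : u₀ ∈ U) (hfu₀ : f u₀ = 0) :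
    ∀ᶠ u in 𝓝 u₀, f u = 0 := by
  obtain ⟨r, hr, hrU⟩ := Metric.nhds_basis_closedBall.mem_iff.mp (hU.mem_nhds hu₀)
  filter_upwards [Metric.ball_mem_nhds u₀ (half_pos hr)] with u₁ hu₁
  by_contra hfu₁
  have hZ : IsCompact (Metric.closedBall u₀ r ∩ f ⁻¹' {0}) :=
    (isCompact_closedBall u₀ r).of_isClosed_subset
      ((hf.continuousOn.mono hrU).preimage_isClosed_of_isClosed Metric.isClosed_closedBall
        isClosed_singleton) Set.inter_subset_left
  obtain ⟨z, ⟨hzr, hfz⟩, hzmin⟩ := hZ.exists_isMinOn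
    ⟨u₀, Metric.mem_closedBall_self hr.le, hfu₀⟩
    (continuous_id.dist continuous_const : Continuous fun u => dist u u₁).continuousOn
  have hfz : f z = 0 := hfz
  have hzu₀ : dist z u₁ ≤ dist u₀ u₁ := hzmin ⟨Metric.mem_closedBall_self hr.le, hfu₀⟩
  have hu₁' : dist u₁ u₀ < r / 2 := hu₁
  have hzU : z ∈ U := hrU hzr
  have hpos : ∀ u, dist u u₁ < dist z u₁ → 0 < f u := by
    intro u hu
    have hur : u ∈ Metric.closedBall u₀ r := by
      have := dist_triangle u u₁ u₀
      rw [dist_comm u₀] at hzu₀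
      exact Metric.mem_closedBall.mpr (by linarith)
    refine (hfnn u (hrU hur)).lt_of_ne fun h0 => ?_
    have : dist z u₁ ≤ dist u u₁ := hzmin ⟨hur, h0.symm⟩
    linarith
  set t : EuclideanSpace ℝ (Fin n) := (1 / 2 : ℝ) • (z - u₁)
  have hzt : z - (u₁ + t) = t := by
    simp only [t]
    module
  have ht : t ≠ 0 := by
    intro h0
    have : z = u₁ + t := sub_eq_zero.mp (hzt.trans h0)
    rw [h0, add_zero] at this
    exact hfu₁ (this ▸ hfz)
  have hnhds := hU.mem_nhds hzU
  have hs : ContDiff ℝ 2 (fun u => ‖t‖ ^ 2 - ‖u - (u₁ + t)‖ ^ 2) :=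
    contDiff_const.sub ((contDiff_id.sub contDiff_const).norm_sq ℝ)
  refine false_of_supersolution_touching (s := fun u => ‖t‖ ^ 2 - ‖u - (u₁ + t)‖ ^ 2) hc
    (ha.continuousAt hnhds) (hb.continuousAt hnhds)
    (eventually_of_mem hnhds hapos)
    (eventually_of_mem hnhds fun u hu => hf.contDiffAt (hU.mem_nhds hu)) hs
    (by simp [hzt]) ?_ (eventually_of_mem hnhds hineq) (eventually_of_mem hnhds hfnn)
    (Eventually.of_forall fun u huz hsu => hpos u ?_) hfz
  · obtain ⟨k, hk⟩ : ∃ k, t k ≠ 0 := by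
      by_contra! h0
      exact ht (by ext k; simpa using h0 k)
    refine ⟨k, ?_⟩
    have h1 : HasFDerivAt (fun u => ‖t‖ ^ 2 - ‖u - (u₁ + t)‖ ^ 2) _ z :=
      (((hasFDerivAt_id z).sub_const (u₁ + t)).norm_sq).const_sub (‖t‖ ^ 2)
    unfold pd
    rw [h1.fderiv]
    simpa [hzt, EuclideanSpace.inner_single_right] using hk
  · -- The ball with diameter `[u₁, z]` meets the sphere about `u₁` through `z` only at `z`.
    have h1 := parallelogram_law_with_norm ℝ (u - (u₁ + t)) t
    have h2 : u - (u₁ + t) + t = u - u₁ := by abel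
    have h3 : u - (u₁ + t) - t = u - z := by
      rw [sub_sub, sub_right_inj]
      nth_rewrite 2 [← hzt]
      abel
    rw [h2, h3] at h1
    have h4 : 0 < ‖u - z‖ := norm_pos_iff.mpr (sub_ne_zero.mpr huz)
    have h5 : ‖z - u₁‖ = 2 * ‖t‖ := by
      simp only [t, norm_smul]
      norm_num
      ring
    rw [dist_eq_norm, dist_eq_norm, h5]
    refine lt_of_pow_lt_pow_left₀ 2 (by positivity) ?_
    nlinarith

/-! ### The Hessian under a change of coordinates -/

section Hessian

variable {E E' : Type*} [NormedAddCommGroup E] [NormedSpace ℝ E]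
  [NormedAddCommGroup E'] [NormedSpace ℝ E']

/-- The Hessian of `F` at `u` for a field `B` of bilinear forms, evaluated on `v` and `w`, when `V`
is the gradient of `F` at `u`: the correction term is the Christoffel symbol of the first kind
contracted with `V`. Passing the gradient as an argument avoids inverting `B`. -/
noncomputable def hessForm (B : E → E →L[ℝ] E →L[ℝ] ℝ) (F : E → ℝ) (u V v w : E) : ℝ :=
  fderiv ℝ (fderiv ℝ F) u v w -
    (1 / 2 : ℝ) * (fderiv ℝ B u v w V + fderiv ℝ B u w v V - fderiv ℝ B u V v w)

theorem fderiv_pullback_form_apply {ψ : E → E'} {B : E' → E' →L[ℝ] E' →L[ℝ] ℝ}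
    {B' : E → E →L[ℝ] E →L[ℝ] ℝ} {u : E} (hψ : ContDiffAt ℝ 2 ψ u)
    (hB : DifferentiableAt ℝ B (ψ u)) (hB' : DifferentiableAt ℝ B' u)
    (hBB' : ∀ᶠ x in 𝓝 u, ∀ v w, B' x v w = B (ψ x) (fderiv ℝ ψ x v) (fderiv ℝ ψ x w))
    (x v w : E) :
    fderiv ℝ B' u x v w =
      fderiv ℝ B (ψ u) (fderiv ℝ ψ u x) (fderiv ℝ ψ u v) (fderiv ℝ ψ u w) +
      B (ψ u) (fderiv ℝ (fderiv ℝ ψ) u x v) (fderiv ℝ ψ u w) +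
      B (ψ u) (fderiv ℝ ψ u v) (fderiv ℝ (fderiv ℝ ψ) u x w) := by
  have hd : HasFDerivAt (fderiv ℝ ψ) (fderiv ℝ (fderiv ℝ ψ) u) u :=
    ((hψ.fderiv_right (m := 1) (by norm_num)).differentiableAt (by norm_num)).hasFDerivAt
  have hψ1 : HasFDerivAt ψ (fderiv ℝ ψ u) u := (hψ.differentiableAt (by norm_num)).hasFDerivAt
  have h1 : HasFDerivAt (fun y => B (ψ y) (fderiv ℝ ψ y v) (fderiv ℝ ψ y w)) _ u :=
    ((hB.hasFDerivAt.comp u hψ1).clm_apply (hd.clm_apply (hasFDerivAt_const v u))).clm_apply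
      (hd.clm_apply (hasFDerivAt_const w u))
  have h2 : HasFDerivAt (fun y => B' y v w) _ u :=
    (hB'.hasFDerivAt.clm_apply (hasFDerivAt_const v u)).clm_apply (hasFDerivAt_const w u)
  have h3 : (fun y => B' y v w) =ᶠ[𝓝 u] fun y => B (ψ y) (fderiv ℝ ψ y v) (fderiv ℝ ψ y w) := by
    filter_upwards [hBB'] with y hy using hy v w
  have h4 := congrArg (fun L => L x) (h2.unique (h1.congr_of_eventuallyEq h3))
  simp at h4
  rw [h4]
  ring

/-- The Hessian is a tensor: the second derivatives of the change of coordinates `ψ` that appear in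
the second derivative of `F ∘ ψ` cancel against those coming from the derivatives of the pulled
back metric. -/
theorem hessForm_pullback {ψ : E → E'} {B : E' → E' →L[ℝ] E' →L[ℝ] ℝ}
    {B' : E → E →L[ℝ] E →L[ℝ] ℝ} {F : E' → ℝ} {u V : E} (hψ : ContDiffAt ℝ 2 ψ u)
    (hF : ContDiffAt ℝ 2 F (ψ u)) (hB : DifferentiableAt ℝ B (ψ u))
    (hsymm : ∀ v w, B (ψ u) v w = B (ψ u) w v) (hB' : DifferentiableAt ℝ B' u)
    (hBB' : ∀ᶠ x in 𝓝 u, ∀ v w, B' x v w = B (ψ x) (fderiv ℝ ψ x v) (fderiv ℝ ψ x w))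
    (hV : ∀ y, B (ψ u) (fderiv ℝ ψ u V) y = fderiv ℝ F (ψ u) y) (v w : E) :
    hessForm B' (F ∘ ψ) u V v w =
      hessForm B F (ψ u) (fderiv ℝ ψ u V) (fderiv ℝ ψ u v) (fderiv ℝ ψ u w) := by
  have hd : HasFDerivAt (fderiv ℝ ψ) (fderiv ℝ (fderiv ℝ ψ) u) u :=
    ((hψ.fderiv_right (m := 1) (by norm_num)).differentiableAt (by norm_num)).hasFDerivAt
  have hψ1 : HasFDerivAt ψ (fderiv ℝ ψ u) u := (hψ.differentiableAt (by norm_num)).hasFDerivAt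
  have hdF : HasFDerivAt (fderiv ℝ F) (fderiv ℝ (fderiv ℝ F) (ψ u)) (ψ u) :=
    ((hF.fderiv_right (m := 1) (by norm_num)).differentiableAt (by norm_num)).hasFDerivAt
  have hsd : ∀ x y, fderiv ℝ (fderiv ℝ ψ) u x y = fderiv ℝ (fderiv ℝ ψ) u y x := fun x y =>
    (hψ.isSymmSndFDerivAt (by simp)).eq x y
  have hcomp : fderiv ℝ (F ∘ ψ) =ᶠ[𝓝 u] fun y => (fderiv ℝ F (ψ y)).comp (fderiv ℝ ψ y) := by
    filter_upwards [hψ.eventually (by simp),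
      hψ.continuousAt.eventually (hF.eventually (by simp))] with y h1 h2
    exact fderiv_comp y (h2.differentiableAt (by norm_num)) (h1.differentiableAt (by norm_num))
  have h2 : fderiv ℝ (fderiv ℝ (F ∘ ψ)) u v w =
      fderiv ℝ (fderiv ℝ F) (ψ u) (fderiv ℝ ψ u v) (fderiv ℝ ψ u w) +
        fderiv ℝ F (ψ u) (fderiv ℝ (fderiv ℝ ψ) u v w) := by
    have h1 : HasFDerivAt (fun y => (fderiv ℝ F (ψ y)).comp (fderiv ℝ ψ y)) _ u :=
      (hdF.comp u hψ1).clm_comp hd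
    rw [hcomp.fderiv_eq, h1.fderiv]
    simp
    ring
  simp only [hessForm, h2, fderiv_pullback_form_apply hψ hB hB' hBB', ← hV]
  rw [hsd w v, hsd V v, hsd V w, hsymm (fderiv ℝ ψ u V),
    hsymm _ (fderiv ℝ ψ u w)]
  ring

end Hessian

/-- The trace of one bilinear form with respect to another does not depend on the basis; `P` is the
matrix of the change of basis. -/
theorem sum_inv_mul_congr_transpose_mul_mul {n : ℕ} {G G' H H' P : Matrix (Fin n) (Fin n) ℝ}
    (hG' : IsUnit G'.det) (hGG' : G' = P.transpose * G * P) (hHH' : H' = P.transpose * H * P) :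
    ∑ i, ∑ j, G'⁻¹ i j * H' i j = ∑ i, ∑ j, G⁻¹ i j * H i j := by
  have htr : ∀ A B : Matrix (Fin n) (Fin n) ℝ,
      ∑ i, ∑ j, A i j * B i j = (A * B.transpose).trace := fun A B => by
    simp [Matrix.trace, Matrix.mul_apply]
  have hP : IsUnit P.det := by
    rw [hGG', Matrix.det_mul] at hG'
    exact isUnit_of_mul_isUnit_right hG'
  rw [htr, htr, hHH', hGG', Matrix.mul_inv_rev, Matrix.mul_inv_rev]
  simp only [Matrix.transpose_mul, Matrix.transpose_transpose]
  have hPt : IsUnit P.transpose.det := by rwa [Matrix.det_transpose]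
  calc (P⁻¹ * (G⁻¹ * P.transpose⁻¹) * (P.transpose * (H.transpose * P))).trace
      = (P⁻¹ * (G⁻¹ * ((P.transpose⁻¹ * P.transpose) * (H.transpose * P)))).trace := by
        simp only [Matrix.mul_assoc]
    _ = ((G⁻¹ * H.transpose * P) * P⁻¹).trace := by
        rw [Matrix.nonsing_inv_mul _ hPt, Matrix.one_mul, Matrix.trace_mul_comm]
        simp only [Matrix.mul_assoc]
    _ = (G⁻¹ * H.transpose).trace := by
        rw [Matrix.mul_assoc _ P, Matrix.mul_nonsing_inv _ hP, Matrix.mul_one]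

/-! ### The metric in a chart -/

section Metric

open Bundle

variable {n : ℕ} {M : Type*} [TopologicalSpace M] [ChartedSpace (EuclideanSpace ℝ (Fin n)) M]
  [IsManifold (𝓡 n) ∞ M] (g : Metric n M)

/-- The metric in the preferred chart at `x₀`, as a field of bilinear forms on the coordinate
space. -/
noncomputable def gForm (x₀ : M) (u : EuclideanSpace ℝ (Fin n)) :
    EuclideanSpace ℝ (Fin n) →L[ℝ] EuclideanSpace ℝ (Fin n) →L[ℝ] ℝ :=
  ContinuousLinearMap.bilinearComp
    (E := EuclideanSpace ℝ (Fin n)) (F := EuclideanSpace ℝ (Fin n))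
    (g.inner ((extChartAt (𝓡 n) x₀).symm u))
    (mfderiv (𝓡 n) (𝓡 n) (extChartAt (𝓡 n) x₀).symm u)
    (mfderiv (𝓡 n) (𝓡 n) (extChartAt (𝓡 n) x₀).symm u)

theorem gForm_apply (x₀ : M) (u v w : EuclideanSpace ℝ (Fin n)) :
    gForm g x₀ u v w = g.inner ((extChartAt (𝓡 n) x₀).symm u)
      (mfderiv (𝓡 n) (𝓡 n) (extChartAt (𝓡 n) x₀).symm u v)
      (mfderiv (𝓡 n) (𝓡 n) (extChartAt (𝓡 n) x₀).symm u w) := rfl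

theorem gMat_apply (x₀ : M) (u : EuclideanSpace ℝ (Fin n)) (i j : Fin n) :
    gMat g x₀ u i j = gForm g x₀ u (EuclideanSpace.single i 1) (EuclideanSpace.single j 1) := rfl

theorem gForm_symm (x₀ : M) (u v w : EuclideanSpace ℝ (Fin n)) :
    gForm g x₀ u v w = gForm g x₀ u w v := g.symm _ _ _

theorem contDiffOn_gForm (x₀ : M) :
    ContDiffOn ℝ ∞ (gForm g x₀) (extChartAt (𝓡 n) x₀).target := by
  have h1 : IsManifold (𝓡 n) 1 M := IsManifold.of_le (n := ∞) (by simp)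
  have hopen : IsOpen (extChartAt (𝓡 n) x₀).target := isOpen_extChartAt_target x₀
  have hsymm := contMDiffOn_extChartAt_symm (I := 𝓡 n) (n := ∞) x₀
  refine contDiffOn_clm_apply.mpr fun v => contDiffOn_clm_apply.mpr fun w => ?_
  have hvec : ∀ v : EuclideanSpace ℝ (Fin n), ContMDiffOn (𝓡 n) ((𝓡 n).prod (𝓡 n)) ∞
      (fun u => TotalSpace.mk' (EuclideanSpace ℝ (Fin n)) (E := TangentSpace (𝓡 n))
        ((extChartAt (𝓡 n) x₀).symm u)
        (mfderiv (𝓡 n) (𝓡 n) (extChartAt (𝓡 n) x₀).symm u v)) (extChartAt (𝓡 n) x₀).target := by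
    intro v
    have h2 := hsymm.contMDiffOn_tangentMapWithin (m := ∞) (by simp) hopen.uniqueMDiffOn
    have h3 : ContMDiff (𝓡 n) ((𝓡 n).prod (𝓡 n)) ∞
      (fun u => TotalSpace.mk' (EuclideanSpace ℝ (Fin n))
        (E := (TangentSpace (𝓡 n) : EuclideanSpace ℝ (Fin n) → Type _)) u v) :=
      contMDiff_vectorSpace_iff_contDiff.mpr contDiff_const
    refine (h2.comp h3.contMDiffOn (fun u hu => hu)).congr fun u hu => ?_
    simp only [Function.comp, tangentMapWithin, mfderivWithin_of_isOpen hopen hu]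
  have key : ContMDiffOn (𝓡 n) 𝓘(ℝ, ℝ) ∞ (fun u => gForm g x₀ u v w)
      (extChartAt (𝓡 n) x₀).target := by
    intro u hu
    have : ContMDiffWithinAt (𝓡 n) ((𝓡 n).prod 𝓘(ℝ)) ∞
        (fun u ↦ TotalSpace.mk' ℝ (E := Bundle.Trivial M ℝ) ((extChartAt (𝓡 n) x₀).symm u)
          (gForm g x₀ u v w)) (extChartAt (𝓡 n) x₀).target u := by
      apply ContMDiffWithinAt.clm_bundle_apply₂ (F₁ := EuclideanSpace ℝ (Fin n))
        (F₂ := EuclideanSpace ℝ (Fin n))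
      · exact ContMDiffAt.comp_contMDiffWithinAt u g.contMDiff.contMDiffAt (hsymm u hu)
      · exact hvec v u hu
      · exact hvec w u hu
    simp only [contMDiffWithinAt_totalSpace] at this
    exact this.2
  exact contMDiffOn_iff_contDiffOn.mp key

/-- In coordinates, a metric read in the chart at `x` is the pull back of the metric read in the
chart at `x₀` by the change of charts. -/
theorem gForm_eq_gForm_comp (x₀ x : M) {u : EuclideanSpace ℝ (Fin n)}
    (hu : u ∈ (extChartAt (𝓡 n) x).target)
    (hu₀ : (extChartAt (𝓡 n) x).symm u ∈ (extChartAt (𝓡 n) x₀).source)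
    (v w : EuclideanSpace ℝ (Fin n)) :
    gForm g x u v w =
      gForm g x₀ (extChartAt (𝓡 n) x₀ ((extChartAt (𝓡 n) x).symm u))
        (fderiv ℝ (extChartAt (𝓡 n) x₀ ∘ (extChartAt (𝓡 n) x).symm) u v)
        (fderiv ℝ (extChartAt (𝓡 n) x₀ ∘ (extChartAt (𝓡 n) x).symm) u w) := by
  have h1 : IsManifold (𝓡 n) 1 M := IsManifold.of_le (n := ∞) (by simp)
  set φ := extChartAt (𝓡 n) x
  set φ₀ := extChartAt (𝓡 n) x₀
  have hto : (extChartAt (𝓡 n) x).target ∈ 𝓝 u := (isOpen_extChartAt_target x).mem_nhds hu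
  have hsymm : ContMDiffAt (𝓡 n) (𝓡 n) 1 φ.symm u :=
    ((contMDiffOn_extChartAt_symm (I := 𝓡 n) (n := 1) x) u hu).contMDiffAt hto
  have hφ₀ : ContMDiffAt (𝓡 n) (𝓡 n) 1 φ₀ (φ.symm u) :=
    contMDiffAt_extChartAt' (by simpa [φ₀] using hu₀)
  have hy : φ₀ (φ.symm u) ∈ φ₀.target := φ₀.map_source hu₀
  have hsymm₀ : ContMDiffAt (𝓡 n) (𝓡 n) 1 φ₀.symm (φ₀ (φ.symm u)) :=
    ((contMDiffOn_extChartAt_symm (I := 𝓡 n) (n := 1) x₀) _ hy).contMDiffAt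
      ((isOpen_extChartAt_target x₀).mem_nhds hy)
  have hψ : ContMDiffAt (𝓡 n) (𝓡 n) 1 (φ₀ ∘ φ.symm) u := hφ₀.comp u hsymm
  have hev : φ.symm =ᶠ[𝓝 u] φ₀.symm ∘ (φ₀ ∘ φ.symm) := by
    filter_upwards [hsymm.continuousAt.eventually
      ((isOpen_extChartAt_source (I := 𝓡 n) x₀).mem_nhds hu₀)] with y hy
    exact (φ₀.left_inv hy).symm
  have hmf : ∀ v : EuclideanSpace ℝ (Fin n),
      (mfderiv (𝓡 n) (𝓡 n) φ.symm u v : EuclideanSpace ℝ (Fin n)) =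
      mfderiv (𝓡 n) (𝓡 n) φ₀.symm (φ₀ (φ.symm u)) (fderiv ℝ (φ₀ ∘ φ.symm) u v) := by
    intro v
    have h2 := hev.mfderiv_eq (I := 𝓡 n) (I' := 𝓡 n)
    rw [mfderiv_comp u (hsymm₀.mdifferentiableAt (by norm_num))
      (hψ.mdifferentiableAt (by norm_num)), mfderiv_eq_fderiv] at h2
    exact congrArg (fun L => L v) h2
  -- Tangent spaces at all points are the same type, so vectors need no transport along `y = z`.
  have key : ∀ y z : M, y = z → ∀ v w : EuclideanSpace ℝ (Fin n),
      g.inner y v w = g.inner z v w := by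
    rintro y _ rfl v w
    rfl
  rw [gForm_apply, gForm_apply]
  refine (key _ _ (φ₀.left_inv hu₀).symm _ _).trans ?_
  exact congrArg₂ (fun v w : EuclideanSpace ℝ (Fin n) => g.inner _ v w) (hmf v) (hmf w)

end Metric

/-! ### Coordinate formula for the Laplacian in an arbitrary chart -/

section Coordinates

variable {n : ℕ} {M : Type*} [TopologicalSpace M] [ChartedSpace (EuclideanSpace ℝ (Fin n)) M]
  [IsManifold (𝓡 n) ∞ M] (g : Metric n M)

theorem gForm_pos (x₀ : M) {u : EuclideanSpace ℝ (Fin n)}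
    (hu : u ∈ (extChartAt (𝓡 n) x₀).target) {v : EuclideanSpace ℝ (Fin n)} (hv : v ≠ 0) :
    0 < gForm g x₀ u v v := by
  have h1 : IsManifold (𝓡 n) 1 M := IsManifold.of_le (n := ∞) (by simp)
  rw [gForm_apply]
  refine g.pos _ _ fun h0 => hv ?_
  have h2 := mfderiv_extChartAt_comp_mfderivWithin_extChartAt_symm (I := 𝓡 n) (x := x₀) hu
  simp only [ModelWithCorners.range_eq_univ, mfderivWithin_univ] at h2
  have h3 := congrArg (fun L => L v) h2
  exact h3.symm.trans ((congrArg _ h0).trans (ContinuousLinearMap.map_zero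
    (mfderiv (𝓡 n) (𝓡 n) (extChartAt (𝓡 n) x₀) ((extChartAt (𝓡 n) x₀).symm u))))

theorem bilin_apply_eq_sum
    (S : EuclideanSpace ℝ (Fin n) →ₗ[ℝ] EuclideanSpace ℝ (Fin n) →ₗ[ℝ] ℝ)
    (v w : EuclideanSpace ℝ (Fin n)) :
    S v w = ∑ i, ∑ j, v i * (w j * S (EuclideanSpace.single i 1) (EuclideanSpace.single j 1)) := by
  have hexp : ∀ v : EuclideanSpace ℝ (Fin n), v = ∑ i, v i • EuclideanSpace.single i (1 : ℝ) :=
    fun v => by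
      simpa using ((EuclideanSpace.basisFun (Fin n) ℝ).sum_repr v).symm
  conv_lhs => rw [hexp v, hexp w]
  simp only [map_sum, map_smul, LinearMap.sum_apply, LinearMap.smul_apply, smul_eq_mul,
    Finset.mul_sum]
  rw [Finset.sum_comm]
  exact Finset.sum_congr rfl fun i _ => Finset.sum_congr rfl fun j _ => by ring

theorem gForm_apply_eq_sum (x₀ : M) (u v w : EuclideanSpace ℝ (Fin n)) :
    gForm g x₀ u v w = ∑ i, ∑ j, v i * (w j * gMat g x₀ u i j) :=
  bilin_apply_eq_sum (LinearMap.mk₂ ℝ (fun v w => gForm g x₀ u v w)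
    (by simp) (by simp) (by simp) (by simp)) v w

theorem hessForm_apply_eq_sum
    (B : EuclideanSpace ℝ (Fin n) →
      EuclideanSpace ℝ (Fin n) →L[ℝ] EuclideanSpace ℝ (Fin n) →L[ℝ] ℝ)
    (F : EuclideanSpace ℝ (Fin n) → ℝ) (u V v w : EuclideanSpace ℝ (Fin n)) :
    hessForm B F u V v w = ∑ i, ∑ j, v i * (w j *
      hessForm B F u V (EuclideanSpace.single i 1) (EuclideanSpace.single j 1)) :=
  bilin_apply_eq_sum (LinearMap.mk₂ ℝ (fun v w => hessForm B F u V v w)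
    (fun _ _ _ => by simp [hessForm]; ring) (fun _ _ _ => by simp [hessForm]; ring)
    (fun _ _ _ => by simp [hessForm]; ring) (fun _ _ _ => by simp [hessForm]; ring)) v w

theorem posDef_gMat (x₀ : M) {u : EuclideanSpace ℝ (Fin n)}
    (hu : u ∈ (extChartAt (𝓡 n) x₀).target) : (gMat g x₀ u).PosDef := by
  refine Matrix.PosDef.of_dotProduct_mulVec_pos ?_ fun v hv => ?_
  · ext i j
    simp only [Matrix.conjTranspose_apply, star_trivial, gMat_apply]
    exact gForm_symm g x₀ u _ _
  · have hv' : WithLp.toLp 2 v ≠ 0 := by simpa using hv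
    refine (gForm_pos g x₀ hu hv').trans_eq ?_
    rw [gForm_apply_eq_sum]
    simp only [dotProduct, Matrix.mulVec, Finset.mul_sum, Pi.star_apply, star_trivial]
    exact Finset.sum_congr rfl fun i _ => Finset.sum_congr rfl fun j _ => by ring

theorem posDef_gInv (x₀ : M) {u : EuclideanSpace ℝ (Fin n)}
    (hu : u ∈ (extChartAt (𝓡 n) x₀).target) : (gInv g x₀ u).PosDef :=
  (posDef_gMat g x₀ hu).inv

theorem differentiableAt_gForm (x₀ : M) {u : EuclideanSpace ℝ (Fin n)}
    (hu : u ∈ (extChartAt (𝓡 n) x₀).target) : DifferentiableAt ℝ (gForm g x₀) u :=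
  ((contDiffOn_gForm g x₀).contDiffAt
    ((isOpen_extChartAt_target x₀).mem_nhds hu)).differentiableAt (by simp)

theorem pd_gMat (x₀ : M) {u : EuclideanSpace ℝ (Fin n)}
    (hu : u ∈ (extChartAt (𝓡 n) x₀).target) (i j l : Fin n) :
    pd i (fun w => gMat g x₀ w j l) u = fderiv ℝ (gForm g x₀) u (EuclideanSpace.single i 1)
      (EuclideanSpace.single j 1) (EuclideanSpace.single l 1) := by
  have h := ((differentiableAt_gForm g x₀ hu).hasFDerivAt.clm_apply
    (hasFDerivAt_const (EuclideanSpace.single j (1 : ℝ)) u)).clm_apply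
    (hasFDerivAt_const (EuclideanSpace.single l (1 : ℝ)) u)
  unfold pd
  simp only [gMat_apply]
  rw [h.fderiv]
  simp

/-- Contracting the Christoffel symbols of the second kind with `∂f` is contracting those of the
first kind with the gradient `V`. -/
theorem hessCoord_eq_hessForm (x₀ : M) {u : EuclideanSpace ℝ (Fin n)}
    (hu : u ∈ (extChartAt (𝓡 n) x₀).target) {f : EuclideanSpace ℝ (Fin n) → ℝ}
    (hf : ContDiffAt ℝ 2 f u) {V : EuclideanSpace ℝ (Fin n)}
    (hV : ∀ y, gForm g x₀ u V y = fderiv ℝ f u y) (i j : Fin n) :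
    hessCoord g x₀ f i j u = hessForm (gForm g x₀) f u V (EuclideanSpace.single i 1)
      (EuclideanSpace.single j 1) := by
  have hexp : V = ∑ l, V l • EuclideanSpace.single l (1 : ℝ) := by
    simpa using ((EuclideanSpace.basisFun (Fin n) ℝ).sum_repr V).symm
  have hunit : IsUnit (gMat g x₀ u).det := (posDef_gMat g x₀ hu).isUnit.map Matrix.detMonoidHom
  have hVl : ∀ l, ∑ k, gInv g x₀ u k l * pd k f u = V l := by
    intro l
    have h1 : ∀ k, pd k f u = ∑ m, V m * gMat g x₀ u m k := fun k => by
      unfold pd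
      rw [← hV]
      conv_lhs => rw [hexp]
      simp [gMat_apply]
    have h2 := congrFun (congrArg (fun A => Matrix.vecMul V A)
      (Matrix.mul_nonsing_inv (gMat g x₀ u) hunit)) l
    simp only [← Matrix.vecMul_vecMul, Matrix.vecMul_one] at h2
    rw [← h2]
    simp only [Matrix.vecMul, dotProduct, h1, gInv]
    exact Finset.sum_congr rfl fun k _ => mul_comm _ _
  unfold hessCoord hessForm
  rw [pd_pd_eq hf]
  congr 1
  conv_rhs => rw [hexp]
  simp only [christoffel, pd_gMat g x₀ hu, map_sum, map_smul, sum_apply, smul_apply, smul_eq_mul,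
    ← hVl, Finset.mul_sum, Finset.sum_mul, ← Finset.sum_add_distrib, ← Finset.sum_sub_distrib]
  rw [Finset.sum_comm]
  exact Finset.sum_congr rfl fun l _ => Finset.sum_congr rfl fun k _ => by ring

theorem exists_gForm_gradient (x₀ : M) {u : EuclideanSpace ℝ (Fin n)}
    (hu : u ∈ (extChartAt (𝓡 n) x₀).target) (L : EuclideanSpace ℝ (Fin n) →L[ℝ] ℝ) :
    ∃ V, ∀ y, gForm g x₀ u V y = L y := by
  set T : EuclideanSpace ℝ (Fin n) →ₗ[ℝ] Module.Dual ℝ (EuclideanSpace ℝ (Fin n)) :=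
    (ContinuousLinearMap.coeLM ℝ).comp (gForm g x₀ u).toLinearMap
  have hinj : Function.Injective T := by
    refine (injective_iff_map_eq_zero T).mpr fun v hv => ?_
    by_contra hne
    have h1 : gForm g x₀ u v v = 0 := congrArg (fun A => A v) hv
    exact (gForm_pos g x₀ hu hne).ne' h1
  have hsurj : Function.Surjective T :=
    (LinearMap.injective_iff_surjective_of_finrank_eq_finrank
      Subspace.dual_finrank_eq.symm).mp hinj
  obtain ⟨V, hV⟩ := hsurj L.toLinearMap
  exact ⟨V, fun y => congrArg (fun A => A y) hV⟩

theorem invGram_eq_gInv (x : M) : invGram g x = gInv g x (extChartAt (𝓡 n) x x) := by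
  unfold invGram gInv
  congr 1
  ext i j
  exact (gMat_self g x i j).symm

theorem hessian_apply_coordBasis (f : M → ℝ) (x : M) (i j : Fin n) :
    hessian g f x (coordBasis x i) (coordBasis x j) =
      hessCoord g x (f ∘ (extChartAt (𝓡 n) x).symm) i j (extChartAt (𝓡 n) x x) := by
  simp [hessian, Finsupp.single_apply, LinearMap.sum_apply]

theorem laplacian_eq_sum (f : M → ℝ) (x : M) :
    laplacian g f x = -∑ i, ∑ j, gInv g x (extChartAt (𝓡 n) x x) i j *
      hessCoord g x (f ∘ (extChartAt (𝓡 n) x).symm) i j (extChartAt (𝓡 n) x x) := by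
  simp only [laplacian, metricTrace, invGram_eq_gInv, hessian_apply_coordBasis]

/-- The Laplacian at any point of the domain of a fixed chart is given by the coordinate formula
of that chart. -/
theorem laplacian_eq_sum_of_mem_source {f : M → ℝ} (hf : ContMDiff (𝓡 n) 𝓘(ℝ, ℝ) ∞ f)
    (x₀ : M) {x : M} (hx : x ∈ (extChartAt (𝓡 n) x₀).source) :
    laplacian g f x = -∑ i, ∑ j, gInv g x₀ (extChartAt (𝓡 n) x₀ x) i j *
      hessCoord g x₀ (f ∘ (extChartAt (𝓡 n) x₀).symm) i j (extChartAt (𝓡 n) x₀ x) := by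
  rw [laplacian_eq_sum]
  set φ := extChartAt (𝓡 n) x
  set φ₀ := extChartAt (𝓡 n) x₀
  have hxφ : φ.symm (φ x) = x := extChartAt_to_inv x
  have hφx : φ x ∈ φ.target := mem_extChartAt_target x
  have hφ₀x : φ₀ x ∈ φ₀.target := φ₀.map_source hx
  have hsymm : ContMDiffAt (𝓡 n) (𝓡 n) ∞ φ.symm (φ x) :=
    ((contMDiffOn_extChartAt_symm (I := 𝓡 n) (n := ∞) x) _ hφx).contMDiffAt
      ((isOpen_extChartAt_target x).mem_nhds hφx)
  have hsymm₀ : ContMDiffAt (𝓡 n) (𝓡 n) ∞ φ₀.symm (φ₀ x) :=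
    ((contMDiffOn_extChartAt_symm (I := 𝓡 n) (n := ∞) x₀) _ hφ₀x).contMDiffAt
      ((isOpen_extChartAt_target x₀).mem_nhds hφ₀x)
  have hφ₀ : ContMDiffAt (𝓡 n) (𝓡 n) ∞ φ₀ (φ.symm (φ x)) :=
    contMDiffAt_extChartAt' (by rw [hxφ]; simpa [φ₀] using hx)
  set ψ : EuclideanSpace ℝ (Fin n) → EuclideanSpace ℝ (Fin n) := φ₀ ∘ φ.symm
  have hψx : ψ (φ x) = φ₀ x := congrArg φ₀ hxφ
  have hψ : ContDiffAt ℝ 2 ψ (φ x) :=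
    (hφ₀.comp (φ x) hsymm).contDiffAt.of_le (WithTop.coe_le_coe.mpr le_top)
  have hF : ContDiffAt ℝ 2 (f ∘ φ₀.symm) (ψ (φ x)) := by
    rw [hψx]
    exact ((hf _).comp (φ₀ x) hsymm₀).contDiffAt.of_le (WithTop.coe_le_coe.mpr le_top)
  have hf' : ContDiffAt ℝ 2 (f ∘ φ.symm) (φ x) :=
    ((hf _).comp (φ x) hsymm).contDiffAt.of_le (WithTop.coe_le_coe.mpr le_top)
  have hsrc : ∀ᶠ u in 𝓝 (φ x), φ.symm u ∈ φ₀.source :=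
    hsymm.continuousAt.eventually
      ((isOpen_extChartAt_source (I := 𝓡 n) x₀).mem_nhds (by rw [hxφ]; exact hx))
  have hfF : f ∘ φ.symm =ᶠ[𝓝 (φ x)] (f ∘ φ₀.symm) ∘ ψ := by
    filter_upwards [hsrc] with u hu
    exact congrArg f (φ₀.left_inv hu).symm
  have hpull : ∀ᶠ u in 𝓝 (φ x), ∀ v w, gForm g x u v w =
      gForm g x₀ (ψ u) (fderiv ℝ ψ u v) (fderiv ℝ ψ u w) := by
    filter_upwards [hsrc, (isOpen_extChartAt_target (I := 𝓡 n) x).mem_nhds hφx] with u hu hu' v w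
    exact gForm_eq_gForm_comp g x₀ x hu' hu v w
  have hpx := hpull.self_of_nhds
  have hinj : Function.Injective (fderiv ℝ ψ (φ x)).toLinearMap := by
    refine (injective_iff_map_eq_zero _).mpr fun v hv => ?_
    by_contra hne
    have h1 := gForm_pos g x hφx hne
    have h2 : fderiv ℝ ψ (φ x) v = 0 := hv
    rw [hpx, h2] at h1
    simp at h1
  have hsurj : Function.Surjective (fderiv ℝ ψ (φ x)).toLinearMap :=
    LinearMap.injective_iff_surjective.mp hinj
  -- The gradient in the chart at `x` is mapped by `ψ` to the gradient in the chart at `x₀`.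
  obtain ⟨V, hV⟩ := exists_gForm_gradient g x hφx (fderiv ℝ (f ∘ φ.symm) (φ x))
  have hV₀ : ∀ y, gForm g x₀ (ψ (φ x)) (fderiv ℝ ψ (φ x) V) y =
      fderiv ℝ (f ∘ φ₀.symm) (ψ (φ x)) y := by
    intro y
    obtain ⟨z, hz⟩ := hsurj y
    have hz : fderiv ℝ ψ (φ x) z = y := hz
    rw [← hz, ← hpx, hV, hfF.fderiv_eq, fderiv_comp _ (hF.differentiableAt (by norm_num))
      (hψ.differentiableAt (by norm_num))]
    rfl
  have hψt : ψ (φ x) ∈ φ₀.target := hψx ▸ hφ₀x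
  rw [← hψx, neg_inj]
  refine sum_inv_mul_congr_transpose_mul_mul (G := gMat g x₀ (ψ (φ x)))
    (H := Matrix.of fun i j => hessCoord g x₀ (f ∘ φ₀.symm) i j (ψ (φ x)))
    (H' := Matrix.of fun i j => hessCoord g x (f ∘ φ.symm) i j (φ x))
    (P := Matrix.of fun k i => fderiv ℝ ψ (φ x) (EuclideanSpace.single i 1) k)
    ((posDef_gMat g x hφx).isUnit.map Matrix.detMonoidHom) ?_ ?_
  · ext i j
    rw [gMat_apply, hpx, gForm_apply_eq_sum]
    simp only [Matrix.mul_apply, Matrix.transpose_apply, Matrix.of_apply, Finset.sum_mul]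
    rw [Finset.sum_comm]
    exact Finset.sum_congr rfl fun k _ => Finset.sum_congr rfl fun l _ => by ring
  · ext i j
    have h2 : hessForm (gForm g x) (f ∘ φ.symm) (φ x) V =
        hessForm (gForm g x) ((f ∘ φ₀.symm) ∘ ψ) (φ x) V := by
      funext v w
      simp only [hessForm, hfF.fderiv.fderiv_eq]
    rw [Matrix.of_apply, hessCoord_eq_hessForm g x hφx hf' hV, h2,
      hessForm_pullback hψ hF (differentiableAt_gForm g x₀ hψt) (gForm_symm g x₀ _)
        (differentiableAt_gForm g x hφx) hpull hV₀, hessForm_apply_eq_sum]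
    simp only [Matrix.mul_apply, Matrix.transpose_apply, Matrix.of_apply, Finset.sum_mul,
      hessCoord_eq_hessForm g x₀ hψt hF hV₀]
    rw [Finset.sum_comm]
    exact Finset.sum_congr rfl fun k _ => Finset.sum_congr rfl fun l _ => by ring

end Coordinates

/-! ### The minimum principle on the manifold and the norm of a tensor -/

section Pointwise

variable {n : ℕ} {M : Type*} [TopologicalSpace M] [ChartedSpace (EuclideanSpace ℝ (Fin n)) M]
  [IsManifold (𝓡 n) ∞ M] (g : Metric n M)

theorem posDef_invGram (x : M) : (invGram g x).PosDef := by
  rw [invGram_eq_gInv]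
  exact posDef_gInv g x (mem_extChartAt_target x)

/-- With `Bᵀ B` the inverse Gram matrix, `|T|²` is the squared Frobenius norm of `B T Bᵀ`. -/
theorem exists_normSq_eq_trace (x : M) : ∃ B : Matrix (Fin n) (Fin n) ℝ, IsUnit B ∧
    ∀ T : LinearMap.BilinForm ℝ (TangentSpace (𝓡 n) x),
      normSq g T =
        ((B * Matrix.of (fun i j => T (coordBasis x i) (coordBasis x j)) * B.conjTranspose) *
          (B * Matrix.of (fun i j => T (coordBasis x i) (coordBasis x j)) *
            B.conjTranspose).conjTranspose).trace := by
  have hA := posDef_invGram g x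
  open scoped MatrixOrder in
  obtain ⟨B, hB⟩ := CStarAlgebra.nonneg_iff_eq_star_mul_self.mp hA.posSemidef.nonneg
  refine ⟨B, ?_, fun T => ?_⟩
  · have h1 := hA.isUnit
    rw [hB] at h1
    rw [Matrix.isUnit_iff_isUnit_det] at h1 ⊢
    rw [Matrix.det_mul] at h1
    exact isUnit_of_mul_isUnit_right h1
  · set t : Matrix (Fin n) (Fin n) ℝ :=
      Matrix.of (fun i j => T (coordBasis x i) (coordBasis x j))
    have h1 : normSq g T = ((invGram g x * t) * (invGram g x).transpose * t.transpose).trace := by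
      simp only [normSq, Matrix.trace, Matrix.diag_apply, Matrix.mul_apply,
        Matrix.transpose_apply, Finset.sum_mul, t, Matrix.of_apply]
      refine Finset.sum_congr rfl fun i _ => Finset.sum_congr rfl fun j _ => ?_
      rw [Finset.sum_comm]
      exact Finset.sum_congr rfl fun k _ => Finset.sum_congr rfl fun l _ => by ring
    have h2 : (invGram g x).transpose = invGram g x := by
      simpa [Matrix.IsHermitian] using hA.isHermitian
    rw [h1, h2, hB]
    simp only [Matrix.conjTranspose_mul, Matrix.conjTranspose_conjTranspose,
      Matrix.star_eq_conjTranspose, Matrix.mul_assoc]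
    rw [Matrix.trace_mul_comm]
    simp only [Matrix.mul_assoc, Matrix.conjTranspose_eq_transpose_of_trivial]

theorem normSq_nonneg {x : M} (T : LinearMap.BilinForm ℝ (TangentSpace (𝓡 n) x)) :
    0 ≤ normSq g T := by
  obtain ⟨B, -, hB⟩ := exists_normSq_eq_trace g x
  rw [hB]
  exact (Matrix.posSemidef_self_mul_conjTranspose _).trace_nonneg

theorem eq_zero_of_normSq_eq_zero {x : M} {T : LinearMap.BilinForm ℝ (TangentSpace (𝓡 n) x)}
    (hT : normSq g T = 0) : T = 0 := by
  obtain ⟨B, hBu, hB⟩ := exists_normSq_eq_trace g x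
  rw [hB, Matrix.trace_mul_conjTranspose_self_eq_zero_iff] at hT
  have hBu' : IsUnit B.conjTranspose := hBu.star
  have h1 := hBu.mul_right_eq_zero.mp (hBu'.mul_left_eq_zero.mp hT)
  refine LinearMap.BilinForm.ext_basis (coordBasis x) fun i j => ?_
  exact congrFun (congrFun h1 i) j

theorem metricTrace_smul_metricForm (c : ℝ) (x : M) :
    metricTrace g (c • metricForm g x) = c * n := by
  have hA := posDef_invGram g x
  set G : Matrix (Fin n) (Fin n) ℝ :=
    Matrix.of fun i j => metricForm g x (coordBasis x i) (coordBasis x j)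
  have hG : IsUnit G.det := by
    have h1 : IsUnit (G⁻¹).det := hA.isUnit.map Matrix.detMonoidHom
    exact Matrix.isUnit_nonsing_inv_det_iff.mp h1
  have hsymm : G.transpose = G := by
    ext i j
    exact g.symm _ _ _
  have h1 : metricTrace g (c • metricForm g x) = c * (G⁻¹ * G.transpose).trace := by
    simp only [metricTrace, Matrix.trace, Matrix.diag_apply, Matrix.mul_apply, Finset.mul_sum,
      Matrix.transpose_apply, LinearMap.smul_apply, smul_eq_mul]
    exact Finset.sum_congr rfl fun i _ => Finset.sum_congr rfl fun j _ => mul_left_comm _ _ _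
  rw [h1, hsymm, Matrix.nonsing_inv_mul _ hG]
  simp

/-- An Einstein constant is determined by the scalar curvature, so an Einstein metric has no
traceless Ricci curvature. -/
theorem tracelessRicci_eq_zero_of_ricci_eq (hn : n ≠ 0) {c : ℝ} {x : M}
    (h : ricci g x = c • metricForm g x) : tracelessRicci g x = 0 := by
  have hn' : (n : ℝ) ≠ 0 := Nat.cast_ne_zero.mpr hn
  have h1 : scalarCurvature g x = c * n := by
    rw [scalarCurvature, h, metricTrace_smul_metricForm]
  rw [tracelessRicci, h, h1]
  have h2 : 1 / (n : ℝ) * (c * n) = c := by field_simp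
  rw [h2]
  exact LinearMap.ext₂ fun v w => sub_self (c * metricForm g x v w)

theorem pd_neg (i : Fin n) (f : EuclideanSpace ℝ (Fin n) → ℝ) : pd i (-f) = -pd i f := by
  funext u
  simp [pd, fderiv_neg]

theorem laplacian_neg (f : M → ℝ) (x : M) : laplacian g (-f) x = -laplacian g f x := by
  have h1 : ∀ i j, hessCoord g x (-f ∘ (extChartAt (𝓡 n) x).symm) i j (extChartAt (𝓡 n) x x) =
      -hessCoord g x (f ∘ (extChartAt (𝓡 n) x).symm) i j (extChartAt (𝓡 n) x x) := fun i j => by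
    simp only [hessCoord, pd_neg, Pi.neg_apply, mul_neg, Finset.sum_neg_distrib]
    ring
  rw [laplacian_eq_sum, laplacian_eq_sum]
  have h2 : (-f) ∘ (extChartAt (𝓡 n) x).symm = -(f ∘ (extChartAt (𝓡 n) x).symm) := rfl
  simp only [h2, h1, mul_neg, Finset.sum_neg_distrib]

theorem contDiffOn_comp_extChartAt_symm {f : M → ℝ} (hf : ContMDiff (𝓡 n) 𝓘(ℝ, ℝ) ∞ f) (x : M) :
    ContDiffOn ℝ 2 (f ∘ (extChartAt (𝓡 n) x).symm) (extChartAt (𝓡 n) x).target :=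
  (contMDiffOn_iff_contDiffOn.mp
    (hf.comp_contMDiffOn (contMDiffOn_extChartAt_symm (I := 𝓡 n) (n := ∞) x))).of_le
    (WithTop.coe_le_coe.mpr le_top)

theorem laplacian_nonpos_of_isLocalMin {f : M → ℝ} (hf : ContMDiff (𝓡 n) 𝓘(ℝ, ℝ) ∞ f) {x : M}
    (hmin : IsLocalMin f x) : laplacian g f x ≤ 0 := by
  have hx : extChartAt (𝓡 n) x x ∈ (extChartAt (𝓡 n) x).target := mem_extChartAt_target x
  have hd : ContDiffAt ℝ 2 (f ∘ (extChartAt (𝓡 n) x).symm) (extChartAt (𝓡 n) x x) :=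
    (contDiffOn_comp_extChartAt_symm hf x).contDiffAt ((isOpen_extChartAt_target x).mem_nhds hx)
  have hloc : IsLocalMin (f ∘ (extChartAt (𝓡 n) x).symm) (extChartAt (𝓡 n) x x) := by
    have hc := continuousAt_extChartAt_symm (I := 𝓡 n) x
    rw [ContinuousAt, extChartAt_to_inv] at hc
    filter_upwards [hc.eventually hmin] with u hu
    simpa [extChartAt_to_inv] using hu
  have h1 := sum_mul_pd_pd_nonneg_of_isLocalMin (posDef_gInv g x hx).posSemidef hd hloc
  rw [laplacian_eq_sum]
  simpa only [hessCoord, pd_eq_zero_of_isLocalMin hloc, mul_zero, Finset.sum_const_zero, sub_zero,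
    Left.neg_nonpos_iff] using h1

theorem contDiffOn_gMat_apply (x₀ : M) (i j : Fin n) :
    ContDiffOn ℝ ∞ (fun u => gMat g x₀ u i j) (extChartAt (𝓡 n) x₀).target :=
  ((contDiffOn_gForm g x₀).clm_apply contDiffOn_const).clm_apply contDiffOn_const

theorem continuousOn_gInv (x₀ : M) : ContinuousOn (gInv g x₀) (extChartAt (𝓡 n) x₀).target := by
  have hG : ContinuousOn (gMat g x₀) (extChartAt (𝓡 n) x₀).target :=
    continuousOn_pi.mpr fun i => continuousOn_pi.mpr fun j =>
      (contDiffOn_gMat_apply g x₀ i j).continuousOn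
  have h1 : gInv g x₀ = fun u => (gMat g x₀ u).det⁻¹ • (gMat g x₀ u).adjugate := by
    funext u
    rw [gInv, Matrix.inv_def, Ring.inverse_eq_inv']
  rw [h1]
  refine ContinuousOn.smul (ContinuousOn.inv₀ ?_ fun u hu => (posDef_gMat g x₀ hu).det_pos.ne') ?_
  · exact (continuous_id.matrix_det).comp_continuousOn hG
  · exact (continuous_id.matrix_adjugate).comp_continuousOn hG

theorem continuousOn_christoffel (x₀ : M) (k i j : Fin n) :
    ContinuousOn (christoffel g x₀ k i j) (extChartAt (𝓡 n) x₀).target := by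
  have hpd : ∀ i j l, ContinuousOn (pd i (fun w => gMat g x₀ w j l))
      (extChartAt (𝓡 n) x₀).target := fun i j l u hu =>
    (contDiffAt_pd (k := 0) ((contDiffOn_gMat_apply g x₀ j l).contDiffAt
      ((isOpen_extChartAt_target x₀).mem_nhds hu)) (by simp) i).continuousAt.continuousWithinAt
  have hinv : ∀ k l, ContinuousOn (fun u => gInv g x₀ u k l) (extChartAt (𝓡 n) x₀).target :=
    fun k l => (continuous_apply_apply k l).comp_continuousOn (continuousOn_gInv g x₀)
  exact continuousOn_const.mul (continuousOn_finsetSum _ fun l _ =>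
    (hinv k l).mul (((hpd i j l).add (hpd j i l)).sub (hpd l i j)))

/-- The strong minimum principle on a manifold, local form: the zeros of a nonnegative function
with `-Δ f ≤ c f` form an open set. -/
theorem isOpen_zeros_of_laplacian_le {f : M → ℝ} (hf : ContMDiff (𝓡 n) 𝓘(ℝ, ℝ) ∞ f)
    (hnn : ∀ x, 0 ≤ f x) {c : ℝ} (hc : 0 ≤ c) (hlap : ∀ x, -laplacian g f x ≤ c * f x) :
    IsOpen {x | f x = 0} := by
  rw [isOpen_iff_mem_nhds]
  intro x₀ hx₀
  set φ := extChartAt (𝓡 n) x₀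
  -- The first-order coefficients of `-Δ` in the chart are `-gⁱʲ Γᵏᵢⱼ`.
  have hb : ContinuousOn (fun u k => -∑ i, ∑ j, gInv g x₀ u i j * christoffel g x₀ k i j u)
      φ.target :=
    continuousOn_pi.mpr fun k => (continuousOn_finsetSum _ fun i _ => continuousOn_finsetSum _
      fun j _ => ((continuous_apply_apply i j).comp_continuousOn (continuousOn_gInv g x₀)).mul
        (continuousOn_christoffel g x₀ k i j)).neg
  have key := eventually_eq_zero_of_supersolution (f := f ∘ φ.symm) hc
    (isOpen_extChartAt_target x₀) (continuousOn_gInv g x₀) hb (fun u hu => posDef_gInv g x₀ hu)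
    (contDiffOn_comp_extChartAt_symm hf x₀) ?_ (fun u _ => hnn _) (u₀ := φ x₀)
    (mem_extChartAt_target x₀)
    (by simpa [φ, extChartAt_to_inv] using hx₀)
  · filter_upwards [(continuousAt_extChartAt (I := 𝓡 n) x₀).eventually key,
      extChartAt_source_mem_nhds (I := 𝓡 n) x₀] with y hy hys
    exact (congrArg f (φ.left_inv hys)).symm.trans hy
  · intro u hu
    have h1 := hlap (φ.symm u)
    rw [laplacian_eq_sum_of_mem_source g hf x₀ (φ.map_target hu), φ.right_inv hu, neg_neg] at h1
    refine le_trans (le_of_eq ?_) h1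
    simp only [hessCoord, mul_sub, Finset.sum_sub_distrib, neg_mul, Finset.sum_neg_distrib,
      Finset.mul_sum, Finset.sum_mul]
    rw [← sub_eq_add_neg]
    refine congrArg₂ (· - ·) rfl ?_
    rw [Finset.sum_comm]
    refine Finset.sum_congr rfl fun i _ => ?_
    rw [Finset.sum_comm]
    exact Finset.sum_congr rfl fun j _ => Finset.sum_congr rfl fun k _ => mul_assoc _ _ _

end Pointwise

end ConformalPressure

theorem mainTheorem3 (n : ℕ) (hn : 3 ≤ n) (M : Type*) [TopologicalSpace M] [T2Space M]
    [CompactSpace M] [ConnectedSpace M] [ChartedSpace (EuclideanSpace ℝ (Fin n)) M]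
    [IsManifold (𝓡 n) ∞ M] (g : ConformalPressure.Metric n M)
    (hg : ConformalPressure.HasScalarCurvatureNegOne g)
    (p : M → ℝ) (hp : ContMDiff (𝓡 n) 𝓘(ℝ, ℝ) ∞ p)
    (hLp : ∀ x, ((n : ℝ) - 1) * ConformalPressure.laplacian g p x + p x =
      2 * ConformalPressure.normSq g (ConformalPressure.tracelessRicci g x)) :
    (∀ x, 0 ≤ p x) ∧
    (((∀ x, p x = 0) ∧ ConformalPressure.RicciEqConstMul g (-1 / (n : ℝ))) ∨
      ((∀ x, 0 < p x) ∧ ¬ ConformalPressure.RicciEqConstMul g (-1 / (n : ℝ)) ∧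
        ¬ ConformalPressure.IsEinstein g)) := by
  have hn1 : 0 < (n : ℝ) - 1 := by
    have : (3 : ℝ) ≤ n := by exact_mod_cast hn
    linarith
  have hlap_neg : ∀ x, IsLocalMin (-p) x → 0 ≤ ConformalPressure.laplacian g p x := by
    intro x hx
    have h1 := ConformalPressure.laplacian_nonpos_of_isLocalMin g hp.neg hx
    have h2 := ConformalPressure.laplacian_neg g p x
    have h3 : ConformalPressure.laplacian g (-p) x ≤ 0 := h1
    linarith
  have hnn : ∀ x, 0 ≤ p x := by
    intro x
    obtain ⟨y, -, hy⟩ := isCompact_univ.exists_isMinOn ⟨x, Set.mem_univ x⟩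
      hp.continuous.continuousOn
    have h1 := ConformalPressure.laplacian_nonpos_of_isLocalMin g hp
      (hy.isLocalMin Filter.univ_mem)
    have h2 := ConformalPressure.normSq_nonneg g (ConformalPressure.tracelessRicci g y)
    have h3 : p y ≤ p x := hy (Set.mem_univ x)
    nlinarith [hLp y]
  refine ⟨hnn, ?_⟩
  have hopen : IsOpen {x | p x = 0} :=
    ConformalPressure.isOpen_zeros_of_laplacian_le g hp hnn (inv_nonneg.mpr hn1.le) fun x => by
      have h2 := ConformalPressure.normSq_nonneg g (ConformalPressure.tracelessRicci g x)
      rw [inv_mul_eq_div, le_div_iff₀ hn1]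
      linarith [hLp x]
  rcases isClopen_iff.mp ⟨isClosed_eq hp.continuous continuous_const, hopen⟩ with h0 | h0
  · right
    have hpos : ∀ x, 0 < p x := fun x =>
      (hnn x).lt_of_ne fun h => Set.eq_empty_iff_forall_notMem.mp h0 x h.symm
    have hE : ¬ ConformalPressure.IsEinstein g := by
      rintro ⟨c, hc⟩
      obtain ⟨y, -, hy⟩ := isCompact_univ.exists_isMinOn Set.univ_nonempty
        hp.continuous.neg.continuousOn
      have h1 := hlap_neg y (hy.isLocalMin Filter.univ_mem)
      have h2 := hLp y
      rw [ConformalPressure.tracelessRicci_eq_zero_of_ricci_eq g (by omega) (hc y)] at h2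
      have h3 : ConformalPressure.normSq g
          (0 : LinearMap.BilinForm ℝ (TangentSpace (𝓡 n) y)) = 0 := by
        simp [ConformalPressure.normSq]
      rw [h3] at h2
      nlinarith [hpos y]
    exact ⟨hpos, fun h => hE ⟨_, h⟩, hE⟩
  · left
    have hz : ∀ x, p x = 0 := fun x => Set.eq_univ_iff_forall.mp h0 x
    refine ⟨hz, fun x => ?_⟩
    have h1 : ConformalPressure.laplacian g p x = 0 := le_antisymm
      (ConformalPressure.laplacian_nonpos_of_isLocalMin g hp
        (Filter.Eventually.of_forall fun y => by rw [hz, hz]))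
      (hlap_neg x (Filter.Eventually.of_forall fun y => by simp [hz]))
    have h2 := hLp x
    rw [h1, hz x] at h2
    have h3 := ConformalPressure.eq_zero_of_normSq_eq_zero g
      (T := ConformalPressure.tracelessRicci g x) (by linarith)
    rw [ConformalPressure.tracelessRicci, hg x] at h3
    refine LinearMap.ext₂ fun v w => ?_
    have h4 : ConformalPressure.ricci g x v w -
        (1 / (n : ℝ) * -1) * ConformalPressure.metricForm g x v w = 0 :=
      congrArg (fun T => T v w) h3
    change ConformalPressure.ricci g x v w = (-1 / (n : ℝ)) * ConformalPressure.metricForm g x v w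
    linear_combination h4
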